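/- Let $c$ be a nonzero integer, let $f_c(x)=x^2+c$, and let $L_c$ be the splitting field over $\mathbb{Q}$ of the second iterate $f_c^2(x)=f_c(f_c(x))=(x^2+c)^2+c$. Then $L_c$ is wildly ramified at $2$. More precisely, $2$ divides $[L_c:\mathbb{Q}]$, there is at least one prime ideal of the ring of integers $\mathcal{O}_{L_c}$ lying over $(2)$ whose ramification index is greater than $1$ and divisible by $2$, and every prime ideal $\mathfrak{p}$ of $\mathcal{O}_{L_c}$ lying over $(2)$ has ramification index $e(\mathfrak{p}/2)\ge 2$ with $2\mid e(\mathfrak{p}/2)$. -/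

import Mathlib

open Polynomial NumberField

noncomputable section

/-- The polynomial `f_c(x) = x² + c`, for an integer `c`, with coefficients viewed in `ℚ`. -/
def quadMap (c : ℤ) : ℚ[X] := X ^ 2 + C (c : ℚ)

/-- The second iterate `f_c²(x) = f_c(f_c(x)) = (x² + c)² + c`. -/
def quadMapIter2 (c : ℤ) : ℚ[X] := (quadMap c).comp (quadMap c)

/-- Sanity check of the expanded form of the second iterate. -/
theorem quadMapIter2_eq (c : ℤ) :
    quadMapIter2 c = (X ^ 2 + C (c : ℚ)) ^ 2 + C (c : ℚ) := by
  simp [quadMapIter2, quadMap]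

/-- A number field `K` is wildly ramified at the rational prime `p` if some prime `P` of the ring
of integers `𝓞 K` lying over `(p)` has ramification index `e(P/p)` greater than `1` and divisible
by `p`.  (The residue fields are finite, so residue extensions are automatically separable.) -/
def IsWildlyRamifiedAt (p : ℕ) (K : Type*) [Field K] : Prop :=
  ∃ P ∈ (Ideal.span {(p : ℤ)}).primesOver (𝓞 K),
    1 < P.ramificationIdx ℤ ∧ p ∣ P.ramificationIdx ℤ

end

/-!
The whole statement reduces to one claim about a single prime: *every prime `P` of `𝓞 L` over `2`
has even ramification index*. Positivity then gives `2 ≤ e(P/2)`, the fundamental identity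
`∑ e f = [L : ℚ]` gives `2 ∣ [L : ℚ]`, and some prime lies over `2`.

For the claim, let `w` be the `P`-adic order on `L`, so that `e = e(P/2) = w 2`. The field `L`
contains `s` with `s² = -c` and `α`, `β` with `α² = -c + s = s (s + 1)` and
`β² = -c - s = s (s - 1)`. Two facts are used: if `x ≠ y` have different orders, then `w (x - y)` is
the smaller one, while if `w x = w y`, then `w x ≤ w (x - y)`.

* If `c` is even, then `w s > 0`, so `s ± 1` are units at `P` and `2 w α = w s = 2 w β`. The two
  numbers `α + β` and `α - β` have product `2 s`, of order `e + 2 w β`, and difference `2 β`, of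
  order `e + w β`. If their orders differed, the smaller one would be `e + w β`, which is too large
  for their sum; so the orders agree and `e + 2 w β` is even (`even_ord_two_of_even`).
* If `c` is odd, then `w s = 0`, so `s + 1` and `s - 1` have even orders. Their product is
  `-(c + 1)` and their difference is `2`. If `c ≡ 1 mod 4`, the sum of their orders is `e`, which is
  thus even. If `c ≡ 3 mod 4`, the sum is at least `2 e`, which forces the smaller of the two even
  orders to be `e` (`even_ord_two_of_odd`). When `c = -1` the number `s ± 1` may vanish, but then
  `2` is a square in `L`.
-/

open WithZero IsDedekindDomain

section Order

/-! ### The additive order attached to a discrete valuation -/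

variable {L : Type*} [Field L] (v : Valuation L ℤᵐ⁰)

/-- The additive order of `x` for a `ℤᵐ⁰`-valued valuation `v`. It takes the junk value `0` at
`x = 0`. -/
def ord (x : L) : ℤ := -log (v x)

theorem ord_mul {x y : L} (hx : x ≠ 0) (hy : y ≠ 0) : ord v (x * y) = ord v x + ord v y := by
  unfold ord
  rw [map_mul, log_mul ((v.ne_zero_iff).2 hx) ((v.ne_zero_iff).2 hy)]
  ring

theorem ord_sq {x : L} (hx : x ≠ 0) : ord v (x ^ 2) = 2 * ord v x := by
  rw [sq, ord_mul v hx hx]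
  ring

theorem ord_neg (x : L) : ord v (-x) = ord v x := by
  unfold ord
  rw [Valuation.map_neg]

theorem ord_eq_zero_of_valuation_eq_one {x : L} (hx : v x = 1) : ord v x = 0 := by
  simp [ord, hx]

theorem ord_lt_ord_iff {x y : L} (hx : x ≠ 0) (hy : y ≠ 0) : ord v x < ord v y ↔ v y < v x := by
  unfold ord
  rw [neg_lt_neg_iff, log_lt_log ((v.ne_zero_iff).2 hy) ((v.ne_zero_iff).2 hx)]

theorem ord_pos_iff {x : L} (hx : x ≠ 0) : 0 < ord v x ↔ v x < 1 := by
  rw [← ord_eq_zero_of_valuation_eq_one v v.map_one, ord_lt_ord_iff v one_ne_zero hx, v.map_one]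

/-- The ultrametric inequality for `x - y`, in a form suited to integer arithmetic. -/
theorem ord_sub_cases {x y : L} (hx : x ≠ 0) (hy : y ≠ 0) (hxy : x - y ≠ 0) :
    (ord v x = ord v y ∧ ord v x ≤ ord v (x - y)) ∨
      (ord v x < ord v y ∧ ord v (x - y) = ord v x) ∨
      (ord v y < ord v x ∧ ord v (x - y) = ord v y) := by
  rcases lt_trichotomy (ord v x) (ord v y) with h | h | h
  · refine Or.inr (Or.inl ⟨h, ?_⟩)
    unfold ord
    rw [v.map_sub_eq_of_lt_left ((ord_lt_ord_iff v hx hy).1 h)]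
  · refine Or.inl ⟨h, not_lt.1 fun hlt => ?_⟩
    have h1 := (ord_lt_ord_iff v hxy hx).1 hlt
    have h2 := (ord_lt_ord_iff v hxy hy).1 (h ▸ hlt)
    exact absurd (v.map_sub x y) (not_le.2 (max_lt h1 h2))
  · refine Or.inr (Or.inr ⟨h, ?_⟩)
    unfold ord
    rw [v.map_sub_eq_of_lt_right ((ord_lt_ord_iff v hy hx).1 h)]

theorem valuation_intCast_le_one (n : ℤ) : v (n : L) ≤ 1 :=
  intCast_mem v.integer n

theorem ord_intCast_nonneg {n : ℤ} (hn : (n : L) ≠ 0) : 0 ≤ ord v (n : L) := by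
  rw [← not_lt, ← ord_eq_zero_of_valuation_eq_one v v.map_one,
    ord_lt_ord_iff v hn one_ne_zero, v.map_one, not_lt]
  exact valuation_intCast_le_one v n

theorem ord_intCast_of_odd {n : ℤ} (hn : Odd n) (h2 : v (2 : L) < 1) : ord v (n : L) = 0 := by
  obtain ⟨k, rfl⟩ := hn
  apply ord_eq_zero_of_valuation_eq_one
  push_cast
  rw [add_comm]
  apply v.map_one_add_of_lt
  rw [map_mul]
  exact (mul_le_of_le_one_right' (valuation_intCast_le_one v k)).trans_lt h2

variable [CharZero L] {v}

/-! ### Parity of the order of two -/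

theorem even_ord_two_of_even (h2 : 0 < ord v (2 : L)) {c : ℤ} (hc0 : c ≠ 0) (hc : Even c)
    {s α β : L} (hs : s ^ 2 = -c) (hα : α ^ 2 = -c + s) (hβ : β ^ 2 = -c - s) :
    Even (ord v (2 : L)) := by
  have two_ne : (2 : L) ≠ 0 := two_ne_zero
  have hcL : (c : L) ≠ 0 := Int.cast_ne_zero.2 hc0
  have hs0 : s ≠ 0 := by
    rintro rfl
    apply hcL
    linear_combination hs
  have hSpos : 0 < ord v s := by
    obtain ⟨k, rfl⟩ := hc.two_dvd
    have hk : (k : L) ≠ 0 := by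
      rintro h
      apply hcL
      push_cast
      rw [h, mul_zero]
    have h1 := ord_sq v hs0
    push_cast at hs
    rw [hs, ord_neg, ord_mul v two_ne hk] at h1
    have := ord_intCast_nonneg v hk
    omega
  have hs1 : v s < 1 := (ord_pos_iff v hs0).1 hSpos
  have hvx : v (s + 1) = 1 := by rw [add_comm]; exact v.map_one_add_of_lt hs1
  have hvy : v (s - 1) = 1 := by rw [v.map_sub_swap]; exact v.map_one_sub_of_lt hs1
  have hx0 : s + 1 ≠ 0 := (v.ne_zero_iff).1 (by rw [hvx]; exact one_ne_zero)
  have hy0 : s - 1 ≠ 0 := (v.ne_zero_iff).1 (by rw [hvy]; exact one_ne_zero)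
  have hα' : α ^ 2 = s * (s + 1) := by linear_combination hα - hs
  have hβ' : β ^ 2 = s * (s - 1) := by linear_combination hβ - hs
  have hβ0 : β ≠ 0 := by
    rintro rfl
    exact mul_ne_zero hs0 hy0 (by rw [← hβ']; ring)
  have hB := ord_sq v hβ0
  rw [hβ', ord_mul v hs0 hy0, ord_eq_zero_of_valuation_eq_one v hvy] at hB
  have hprod : (α + β) * (α - β) = 2 * s := by linear_combination hα - hβ
  have hP0 : α + β ≠ 0 := left_ne_zero_of_mul (hprod ▸ mul_ne_zero two_ne hs0)
  have hQ0 : α - β ≠ 0 := right_ne_zero_of_mul (hprod ▸ mul_ne_zero two_ne hs0)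
  have hPQ := ord_mul v hP0 hQ0
  rw [hprod, ord_mul v two_ne hs0] at hPQ
  have hd : (α + β) - (α - β) = 2 * β := by ring
  have htri := ord_sub_cases v hP0 hQ0 (hd ▸ mul_ne_zero two_ne hβ0)
  rw [hd, ord_mul v two_ne hβ0] at htri
  rw [Int.even_iff]
  omega

theorem even_ord_two_of_odd (h2 : 0 < ord v (2 : L)) {c : ℤ} (hc : Odd c)
    {s α β : L} (hs : s ^ 2 = -c) (hα : α ^ 2 = -c + s) (hβ : β ^ 2 = -c - s) :
    Even (ord v (2 : L)) := by
  have two_ne : (2 : L) ≠ 0 := two_ne_zero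
  have hv2 : v (2 : L) < 1 := (ord_pos_iff v two_ne).1 h2
  have hα' : α ^ 2 = s * (s + 1) := by linear_combination hα - hs
  have hβ' : β ^ 2 = s * (s - 1) := by linear_combination hβ - hs
  have hprod : (s + 1) * (s - 1) = -((c + 1 : ℤ) : L) := by
    push_cast
    linear_combination hs
  have of_sq_eq_two {γ : L} (hγ : γ ^ 2 = 2) : Even (ord v (2 : L)) := by
    have hγ0 : γ ≠ 0 := by
      rintro rfl
      exact two_ne (by rw [← hγ]; ring)
    rw [← hγ, ord_sq v hγ0]
    exact even_two_mul _
  by_cases hx0 : s + 1 = 0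
  · obtain rfl : s = -1 := by linear_combination hx0
    exact of_sq_eq_two (hβ'.trans (by ring))
  by_cases hy0 : s - 1 = 0
  · obtain rfl : s = 1 := by linear_combination hy0
    exact of_sq_eq_two (hα'.trans (by ring))
  have hcL : (c : L) ≠ 0 := Int.cast_ne_zero.2 (by rintro rfl; simp at hc)
  have hs0 : s ≠ 0 := by
    rintro rfl
    apply hcL
    linear_combination hs
  have hα0 : α ≠ 0 := by
    rintro rfl
    exact mul_ne_zero hs0 hx0 (by rw [← hα']; ring)
  have hβ0 : β ≠ 0 := by
    rintro rfl
    exact mul_ne_zero hs0 hy0 (by rw [← hβ']; ring)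
  have hS := ord_sq v hs0
  rw [hs, ord_neg, ord_intCast_of_odd v hc hv2] at hS
  have hA := ord_sq v hα0
  rw [hα', ord_mul v hs0 hx0] at hA
  have hB := ord_sq v hβ0
  rw [hβ', ord_mul v hs0 hy0] at hB
  have hXY := ord_mul v hx0 hy0
  rw [hprod, ord_neg] at hXY
  have hd : (s + 1) - (s - 1) = 2 := by ring
  have htri := ord_sub_cases v hx0 hy0 (hd ▸ two_ne)
  rw [hd] at htri
  have hc1 : ((c + 1 : ℤ) : L) ≠ 0 := neg_ne_zero.1 (hprod ▸ mul_ne_zero hx0 hy0)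
  obtain ⟨n, hn⟩ := hc.add_one.two_dvd
  rw [hn, Int.cast_mul, Int.cast_ofNat] at hc1 hXY
  have hn0 := right_ne_zero_of_mul hc1
  rw [ord_mul v two_ne hn0] at hXY
  rw [Int.even_iff]
  rcases Int.even_or_odd n with hne | hno
  · obtain ⟨m, rfl⟩ := hne.two_dvd
    rw [Int.cast_mul, Int.cast_ofNat] at hn0 hXY
    have hm0 := right_ne_zero_of_mul hn0
    rw [ord_mul v two_ne hm0] at hXY
    have := ord_intCast_nonneg v hm0
    omega
  · rw [ord_intCast_of_odd v hno hv2] at hXY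
    omega

end Order

/-! ### Ramification indices and roots of the second iterate -/

theorem ord_two_eq_ramificationIdx {L : Type*} [Field L] [NumberField L]
    (w : HeightOneSpectrum (𝓞 L)) [w.asIdeal.LiesOver (Ideal.span {(2 : ℤ)})] :
    ord (w.valuation L) 2 = w.asIdeal.ramificationIdx ℤ := by
  have hmap : (Ideal.span {(2 : ℤ)}).map (algebraMap ℤ (𝓞 L)) = Ideal.span {(2 : 𝓞 L)} := by
    rw [Ideal.map_span, Set.image_singleton, map_ofNat]
  have hne : Ideal.span {(2 : 𝓞 L)} ≠ ⊥ := by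
    rw [Ne, Ideal.span_singleton_eq_bot]
    exact two_ne_zero
  have := w.isPrime
  rw [Ideal.IsDedekindDomain.ramificationIdx_eq_multiplicity (Ideal.span {(2 : ℤ)}) w.asIdeal
    (hmap ▸ hne), hmap]
  have h2 : (2 : L) = algebraMap (𝓞 L) L 2 := (map_ofNat _ 2).symm
  rw [ord, h2, w.valuation_of_algebraMap, w.intValuation_eq_exp_neg_multiplicity two_ne_zero,
    log_exp, neg_neg]

/-- A splitting field of the second iterate contains `s = √(-c)` together with square roots of
`-c + s` and `-c - s`. -/
theorem exists_sqrt_of_splits (c : ℤ) {L : Type*} [Field L] [Algebra ℚ L]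
    (h : ((quadMapIter2 c).map (algebraMap ℚ L)).Splits) :
    ∃ s α β : L, s ^ 2 = -c ∧ α ^ 2 = -c + s ∧ β ^ 2 = -c - s := by
  have hmap : (quadMapIter2 c).map (algebraMap ℚ L) = (X ^ 2 + C (c : L)) ^ 2 + C (c : L) := by
    rw [quadMapIter2_eq]
    simp
  rw [hmap] at h
  have hdeg : ((X ^ 2 + C (c : L)) ^ 2 + C (c : L)).degree = 4 := by compute_degree!
  have hne : (X ^ 2 + C (c : L)) ^ 2 + C (c : L) ≠ 0 := by
    rintro h0
    rw [h0, degree_zero] at hdeg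
    exact absurd hdeg (by decide)
  obtain ⟨α, hα⟩ := h.exists_eval_eq_zero (by rw [hdeg]; decide)
  simp only [eval_add, eval_pow, eval_X, eval_C] at hα
  -- With `s = α² + c`, the iterate factors as `(X² + c - s) (X² + c + s)`.
  have hdvd : X ^ 2 + C ((c : L) + (α ^ 2 + c)) ∣ (X ^ 2 + C (c : L)) ^ 2 + C (c : L) := by
    refine ⟨X ^ 2 + C ((c : L) - (α ^ 2 + c)), ?_⟩
    have hC : C ((α ^ 2 + c : L) ^ 2 + c) = 0 := by rw [hα, C_0]
    simp only [C_add, C_sub, C_pow] at hC ⊢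
    linear_combination hC
  have hdeg2 : (X ^ 2 + C ((c : L) + (α ^ 2 + c))).degree = 2 := by compute_degree!
  obtain ⟨β, hβ⟩ := (h.of_dvd hne hdvd).exists_eval_eq_zero (by rw [hdeg2]; decide)
  simp only [eval_add, eval_pow, eval_X, eval_C] at hβ
  exact ⟨α ^ 2 + c, α, β, by linear_combination hα, by ring, by linear_combination hβ⟩

theorem even_ramificationIdx {c : ℤ} (hc : c ≠ 0) {L : Type*} [Field L] [NumberField L]
    (h : ((quadMapIter2 c).map (algebraMap ℚ L)).Splits) (P : Ideal (𝓞 L)) [P.IsPrime]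
    [P.LiesOver (Ideal.span {(2 : ℤ)})] : Even (P.ramificationIdx ℤ) := by
  have hP : P ≠ ⊥ := Ideal.ne_bot_of_liesOver_of_ne_bot (p := Ideal.span {(2 : ℤ)}) (by simp) P
  let w : HeightOneSpectrum (𝓞 L) := ⟨P, ‹_›, hP⟩
  have : w.asIdeal.LiesOver (Ideal.span {(2 : ℤ)}) := ‹P.LiesOver _›
  have hw : ord (w.valuation L) 2 = P.ramificationIdx ℤ := ord_two_eq_ramificationIdx w
  have hpos : 0 < ord (w.valuation L) 2 := by
    rw [hw]
    exact_mod_cast Ideal.ramificationIdx_pos P ℤ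
  obtain ⟨s, α, β, hs, hα, hβ⟩ := exists_sqrt_of_splits c h
  rw [← Int.even_coe_nat, ← hw]
  rcases Int.even_or_odd c with hce | hco
  · exact even_ord_two_of_even hpos hc hce hs hα hβ
  · exact even_ord_two_of_odd hpos hco hs hα hβ

theorem theorem1p1 (c : ℤ) (hc : c ≠ 0) (L : Type*) [Field L] [Algebra ℚ L]
    [Polynomial.IsSplittingField ℚ L (quadMapIter2 c)] :
    IsWildlyRamifiedAt 2 L ∧
      2 ∣ Module.finrank ℚ L ∧
      ∀ P ∈ (Ideal.span {((2 : ℕ) : ℤ)}).primesOver (𝓞 L),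
        2 ≤ P.ramificationIdx ℤ ∧ 2 ∣ P.ramificationIdx ℤ := by
  have : CharZero L := algebraRat.charZero L
  have : FiniteDimensional ℚ L := IsSplittingField.finiteDimensional L (quadMapIter2 c)
  -- `NumberField` uses the canonical `ℚ`-algebra structure on `L`.
  obtain rfl : ‹Algebra ℚ L› = DivisionRing.toRatAlgebra := Subsingleton.elim _ _
  have : NumberField L := ⟨⟩
  have hsplit := IsSplittingField.splits L (quadMapIter2 c)
  have key : ∀ P ∈ (Ideal.span {((2 : ℕ) : ℤ)}).primesOver (𝓞 L),
      2 ≤ P.ramificationIdx ℤ ∧ 2 ∣ P.ramificationIdx ℤ := by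
    rintro P ⟨hP, hP2⟩
    rw [Nat.cast_ofNat] at hP2
    have hdvd := (even_ramificationIdx hc hsplit P).two_dvd
    exact ⟨Nat.le_of_dvd (Ideal.ramificationIdx_pos P ℤ) hdvd, hdvd⟩
  have hprime : (Ideal.span {((2 : ℕ) : ℤ)}).IsPrime :=
    (Ideal.span_singleton_prime (by norm_num)).2 Int.prime_two
  refine ⟨?_, ?_, key⟩
  · obtain ⟨⟨P, hP⟩⟩ := (Ideal.span {((2 : ℕ) : ℤ)}).nonempty_primesOver (S := 𝓞 L)
    exact ⟨P, hP, (key P hP).1, (key P hP).2⟩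
  · have : (Ideal.span {((2 : ℕ) : ℤ)}).IsMaximal := hprime.isMaximal (by simp)
    have := Fintype.ofFinite ((Ideal.span {((2 : ℕ) : ℤ)}).primesOver (𝓞 L))
    rw [← RingOfIntegers.rank L, ← Ideal.sum_ramification_inertia_eq_finrank
      (R := ℤ) (S := 𝓞 L) (p := Ideal.span {((2 : ℕ) : ℤ)})]
    exact Finset.dvd_sum fun q _ => (key q.1 q.2).2.mul_right _
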